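/- Let $(B,g)$ and $(F,\ddot g)$ be smooth surfaces (2-dimensional manifolds, $F$ non-empty) with smooth Riemannian or, more generally, pseudo-Riemannian metrics, and let $f:B\to(0,\infty)$ be a smooth function. Suppose that 1. the scalar curvature of $(B,g)$ is a multiple of $f$: $R_B=c\,f$ for some constant $c\in\mathbb R$; 2. $(F,\ddot g)$ is Einstein, $\ddot{\mathrm{Ric}}=\mu\,\ddot g$, with a constant $\mu\neq0$; 3. the warped product $B\times_f F=(B\times F,\ \bar g=g+f^2\ddot g)$ is Ricci-flat, $\overline{\mathrm{Ric}}=0$. Then $g$ is flat (its Riemann curvature tensor vanishes identically), and $f$ is an affine function on $(B,g)$, that is, for every geodesic $\gamma$ of $(B,g)$ defined on an open interval, $f(\gamma(t))=at+b$ for some constants $a,b\in\mathbb R$. -/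

import Mathlib

open Set
open scoped Manifold ContDiff

set_option maxSynthPendingDepth 3

noncomputable section

/-! ### Local pseudo-Riemannian geometry

`G : E → (E →L[ℝ] E →L[ℝ] ℝ)` is a field of bilinear forms on (an open part of) a
finite-dimensional vector space `E`; it plays the role of the coefficients `g_ij` of a metric in a
chart. Everything is written without choosing a basis of `E`. -/

namespace LocalMetric

variable {E : Type*} [NormedAddCommGroup E] [NormedSpace ℝ E]

/-- Christoffel symbols of the first kind, as a trilinear form:
`(u, v, w) ↦ ½ (∂_u G(v, w) + ∂_v G(u, w) - ∂_w G(u, v))`. -/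
def christoffelFst (G : E → (E →L[ℝ] E →L[ℝ] ℝ)) (y : E) : E →L[ℝ] E →L[ℝ] E →L[ℝ] ℝ :=
  let D : E →L[ℝ] E →L[ℝ] E →L[ℝ] ℝ := fderiv ℝ G y
  let D' : E →L[ℝ] E →L[ℝ] E →L[ℝ] ℝ :=
    (ContinuousLinearMap.flipₗᵢ ℝ E E ℝ).toContinuousLinearEquiv.toContinuousLinearMap.comp D.flip
  (1 / 2 : ℝ) • (D + D.flip - D')

theorem christoffelFst_apply (G : E → (E →L[ℝ] E →L[ℝ] ℝ)) (y u v w : E) :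
    christoffelFst G y u v w =
      1 / 2 * (fderiv ℝ G y u v w + fderiv ℝ G y v u w - fderiv ℝ G y w u v) := rfl

/-- Christoffel symbols (of the second kind) `Γ(u, v)` of the Levi-Civita connection, obtained by
raising the last index; where `G y` is nondegenerate and `E` is finite-dimensional,
`(G y).inverse` is the inverse of `v ↦ G y v`. -/
def christoffel (G : E → (E →L[ℝ] E →L[ℝ] ℝ)) (y : E) : E →L[ℝ] E →L[ℝ] E :=
  (ContinuousLinearMap.compL ℝ E (E →L[ℝ] ℝ) E (G y).inverse).comp (christoffelFst G y)

theorem christoffel_apply (G : E → (E →L[ℝ] E →L[ℝ] ℝ)) (y u v : E) :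
    christoffel G y u v = (G y).inverse (christoffelFst G y u v) := rfl

/-- Riemann curvature
`R(u, v) w = ∂_u Γ(v, w) - ∂_v Γ(u, w) + Γ(u, Γ(v, w)) - Γ(v, Γ(u, w))`. -/
def riemann (G : E → (E →L[ℝ] E →L[ℝ] ℝ)) (y : E) : E →L[ℝ] E →L[ℝ] E →L[ℝ] E :=
  fderiv ℝ (christoffel G) y - (fderiv ℝ (christoffel G) y).flip
    + (ContinuousLinearMap.compL ℝ E E E).bilinearComp (christoffel G y) (christoffel G y)
    - ((ContinuousLinearMap.compL ℝ E E E).bilinearComp (christoffel G y) (christoffel G y)).flip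

theorem riemann_apply (G : E → (E →L[ℝ] E →L[ℝ] ℝ)) (y u v w : E) :
    riemann G y u v w =
      fderiv ℝ (christoffel G) y u v w - fderiv ℝ (christoffel G) y v u w
        + christoffel G y u (christoffel G y v w)
        - christoffel G y v (christoffel G y u w) := rfl

variable [FiniteDimensional ℝ E]

/-- Ricci curvature `Ric(v, w) = tr (u ↦ R(u, v) w)`. -/
def ricci (G : E → (E →L[ℝ] E →L[ℝ] ℝ)) (y : E) : E →L[ℝ] E →L[ℝ] ℝ :=
  LinearMap.toContinuousLinearMap
    { toFun := fun v => LinearMap.toContinuousLinearMap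
        { toFun := fun w => LinearMap.trace ℝ E (((riemann G y).flip v).flip w : E →L[ℝ] E)
          map_add' := fun a b => by simp
          map_smul' := fun a b => by simp }
      map_add' := fun a b => by ext; simp
      map_smul' := fun a b => by ext; simp }

theorem ricci_apply (G : E → (E →L[ℝ] E →L[ℝ] ℝ)) (y v w : E) :
    ricci G y v w = LinearMap.trace ℝ E (((riemann G y).flip v).flip w : E →L[ℝ] E) := rfl

/-- Scalar curvature: the `G`-trace of the Ricci curvature. -/
def scalar (G : E → (E →L[ℝ] E →L[ℝ] ℝ)) (y : E) : ℝ :=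
  LinearMap.trace ℝ E ((G y).inverse.comp (ricci G y) : E →L[ℝ] E)

end LocalMetric

/-! ### Manifolds (without boundary) -/

section Manifold

variable {E : Type*} [NormedAddCommGroup E] [NormedSpace ℝ E]
  {H : Type*} [TopologicalSpace H] (I : ModelWithCorners ℝ E H)
  (M : Type*) [TopologicalSpace M] [ChartedSpace H M]

/-- A field of bilinear forms on the tangent spaces of `M` (a covariant 2-tensor field). -/
abbrev BilinField : Type _ :=
  ∀ x : M, TangentSpace I x →L[ℝ] TangentSpace I x →L[ℝ] ℝ

/-- A smooth pseudo-Riemannian metric on `M`: a smooth field of symmetric nondegenerate bilinear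
forms on the tangent spaces. Riemannian metrics are those that are moreover positive definite. -/
structure PseudoRiemannianMetric [IsManifold I ∞ M] where
  val : BilinField I M
  symm : ∀ (x : M) (v w : TangentSpace I x), val x v w = val x w v
  nondegenerate : ∀ (x : M) (v : TangentSpace I x), (∀ w, val x v w = 0) → v = 0
  contMDiff : ContMDiff I (I.prod 𝓘(ℝ, E →L[ℝ] E →L[ℝ] ℝ)) ∞
    (fun x => Bundle.TotalSpace.mk' (E →L[ℝ] E →L[ℝ] ℝ)
      (E := fun x : M => TangentSpace I x →L[ℝ] TangentSpace I x →L[ℝ] ℝ) x (val x))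

variable {I M}

/-- The field `g` read in the chart `φ` at `x₀`: the pullback of `g` by `φ⁻¹`, that is
`y ↦ ((u, v) ↦ g_{φ⁻¹ y} (d(φ⁻¹)_y u, d(φ⁻¹)_y v))`. -/
def BilinField.inChart (g : BilinField I M) (x₀ : M) (y : E) : E →L[ℝ] E →L[ℝ] ℝ :=
  let L : E →L[ℝ] TangentSpace I ((extChartAt I x₀).symm y) :=
    mfderivWithin 𝓘(ℝ, E) I (extChartAt I x₀).symm (range I) y
  (ContinuousLinearMap.precomp ℝ L).comp ((g ((extChartAt I x₀).symm y)).comp L)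

/-- `g` is flat: its Riemann curvature vanishes (in every chart, at every point of the chart). -/
def IsFlat (g : BilinField I M) : Prop :=
  ∀ x₀ : M, ∀ y ∈ (extChartAt I x₀).target, LocalMetric.riemann (g.inChart x₀) y = 0

/-- `Ric_g = lam • g` with the constant `lam`. For `lam = 0` this says that `g` is Ricci-flat. -/
def IsEinstein [FiniteDimensional ℝ E] (g : BilinField I M) (lam : ℝ) : Prop :=
  ∀ x₀ : M, ∀ y ∈ (extChartAt I x₀).target,
    LocalMetric.ricci (g.inChart x₀) y = lam • g.inChart x₀ y

/-- The function `S` is the scalar curvature of `g`. -/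
def IsScalarCurvature [FiniteDimensional ℝ E] (g : BilinField I M) (S : M → ℝ) : Prop :=
  ∀ x₀ : M, ∀ y ∈ (extChartAt I x₀).target,
    LocalMetric.scalar (g.inChart x₀) y = S ((extChartAt I x₀).symm y)

/-- `γ` is a smooth geodesic of `g` on the set `s` of parameters: in every chart it satisfies
`c'' + Γ(c', c') = 0`. -/
def IsGeodesicOn (g : BilinField I M) (γ : ℝ → M) (s : Set ℝ) : Prop :=
  ContMDiffOn 𝓘(ℝ, ℝ) I ∞ γ s ∧
    ∀ x₀ : M, ∀ t ∈ s, γ t ∈ (extChartAt I x₀).source →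
      deriv (deriv (fun τ => extChartAt I x₀ (γ τ))) t
        + LocalMetric.christoffel (g.inChart x₀) (extChartAt I x₀ (γ t))
            (deriv (fun τ => extChartAt I x₀ (γ τ)) t)
            (deriv (fun τ => extChartAt I x₀ (γ τ)) t) = 0

/-- `f` is an affine function on `(M, g)`: along each geodesic, defined on an open interval, it is
an affine function of the parameter. -/
def IsAffineFunction (g : BilinField I M) (f : M → ℝ) : Prop :=
  ∀ (γ : ℝ → M) (s : Set ℝ), IsOpen s → s.OrdConnected → IsGeodesicOn g γ s →
    ∃ a b : ℝ, ∀ t ∈ s, f (γ t) = a * t + b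

end Manifold

section WarpedProduct

variable {E : Type*} [NormedAddCommGroup E] [NormedSpace ℝ E]
  {H : Type*} [TopologicalSpace H] {I : ModelWithCorners ℝ E H}
  {B : Type*} [TopologicalSpace B] [ChartedSpace H B]
  {E' : Type*} [NormedAddCommGroup E'] [NormedSpace ℝ E']
  {H' : Type*} [TopologicalSpace H'] {J : ModelWithCorners ℝ E' H'}
  {F : Type*} [TopologicalSpace F] [ChartedSpace H' F]

/-- The warped product metric `π_B^* g + (f ∘ π_B)² π_F^* h` on `B × F`. -/
def warpedProduct (g : BilinField I B) (f : B → ℝ) (h : BilinField J F) :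
    BilinField (I.prod J) (B × F) := fun p =>
  let P : TangentSpace (I.prod J) p →L[ℝ] TangentSpace I p.1 := mfderiv (I.prod J) I Prod.fst p
  let Q : TangentSpace (I.prod J) p →L[ℝ] TangentSpace J p.2 := mfderiv (I.prod J) J Prod.snd p
  (ContinuousLinearMap.precomp ℝ P).comp ((g p.1).comp P)
    + (f p.1) ^ 2 • (ContinuousLinearMap.precomp ℝ Q).comp ((h p.2).comp Q)

end WarpedProduct

end

noncomputable section

namespace LocalMetric

open Topology

variable {E : Type*} [NormedAddCommGroup E] [NormedSpace ℝ E]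

/-- `G` is a smooth pseudo-Riemannian metric on the open set `U` of the vector space `E`. -/
structure IsMetricOn (G : E → (E →L[ℝ] E →L[ℝ] ℝ)) (U : Set E) : Prop where
  isOpen : IsOpen U
  contDiffOn : ContDiffOn ℝ ∞ G U
  symm : ∀ y ∈ U, ∀ v w, G y v w = G y w v
  isInvertible : ∀ y ∈ U, (G y).IsInvertible

/-- The gradient of `φ` with respect to `G`. -/
def grad (G : E → (E →L[ℝ] E →L[ℝ] ℝ)) (φ : E → ℝ) (y : E) : E :=
  (G y).inverse (fderiv ℝ φ y)

/-- The Hessian of `φ` with respect to the Levi-Civita connection of `G`. -/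
def hess (G : E → (E →L[ℝ] E →L[ℝ] ℝ)) (φ : E → ℝ) (y u v : E) : ℝ :=
  fderiv ℝ (fderiv ℝ φ) y u v - fderiv ℝ φ y (christoffel G y u v)

theorem apply_inverse_apply {g : E →L[ℝ] E →L[ℝ] ℝ} (hg : g.IsInvertible) (α : E →L[ℝ] ℝ) :
    g (g.inverse α) = α := by
  obtain ⟨e, rfl⟩ := hg
  simp

theorem eq_of_forall_apply_eq {g : E →L[ℝ] E →L[ℝ] ℝ} (hg : g.IsInvertible) {v w : E}
    (h : ∀ z, g v z = g w z) : v = w :=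
  hg.injective (ContinuousLinearMap.ext h)

theorem hasFDerivAt_apply_apply {F₁ F₂ F₃ : Type*} [NormedAddCommGroup F₁] [NormedSpace ℝ F₁]
    [NormedAddCommGroup F₂] [NormedSpace ℝ F₂] [NormedAddCommGroup F₃] [NormedSpace ℝ F₃]
    {c : E → F₁ →L[ℝ] F₂ →L[ℝ] F₃} {y : E} (hc : DifferentiableAt ℝ c y) (v : F₁) (w : F₂) :
    HasFDerivAt (fun z => c z v w) (((fderiv ℝ c y).flip v).flip w) y := by
  have h1 := hc.hasFDerivAt.clm_apply (hasFDerivAt_const v y)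
  have h2 := h1.clm_apply (hasFDerivAt_const w y)
  convert h2 using 1
  ext u
  simp

namespace IsMetricOn

variable {G : E → (E →L[ℝ] E →L[ℝ] ℝ)} {U : Set E} (hG : IsMetricOn G U) {y : E} (hy : y ∈ U)

include hG hy

theorem mem_nhds : U ∈ 𝓝 y := hG.isOpen.mem_nhds hy

theorem contDiffAt : ContDiffAt ℝ ∞ G y := hG.contDiffOn.contDiffAt (hG.mem_nhds hy)

theorem differentiableAt : DifferentiableAt ℝ G y := (hG.contDiffAt hy).differentiableAt (by simp)

theorem contDiffAt_fderiv : ContDiffAt ℝ ∞ (fderiv ℝ G) y :=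
  (hG.contDiffAt hy).fderiv_right (by simp)

theorem fderiv_symm (u v w : E) : fderiv ℝ G y u v w = fderiv ℝ G y u w v := by
  have h1 := hasFDerivAt_apply_apply (hG.differentiableAt hy) v w
  have h2 := hasFDerivAt_apply_apply (hG.differentiableAt hy) w v
  have h3 : (fun z => G z v w) =ᶠ[𝓝 y] fun z => G z w v := by
    filter_upwards [hG.mem_nhds hy] with z hz using hG.symm z hz v w
  simpa using DFunLike.congr_fun (h1.unique (h2.congr_of_eventuallyEq h3)) u

theorem apply_christoffel (u v w : E) :
    G y (christoffel G y u v) w =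
      1 / 2 * (fderiv ℝ G y u v w + fderiv ℝ G y v u w - fderiv ℝ G y w u v) := by
  rw [christoffel_apply, apply_inverse_apply (hG.isInvertible y hy), christoffelFst_apply]

/-- The Levi-Civita connection is compatible with the metric. -/
theorem fderiv_eq (u v w : E) :
    fderiv ℝ G y u v w = G y (christoffel G y u v) w + G y v (christoffel G y u w) := by
  rw [hG.symm y hy v, hG.apply_christoffel hy, hG.apply_christoffel hy, hG.fderiv_symm hy u w v,
    hG.fderiv_symm hy v u w, hG.fderiv_symm hy w u v]
  ring

theorem contDiffAt_christoffelFst : ContDiffAt ℝ ∞ (christoffelFst G) y := by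
  have h := hG.contDiffAt_fderiv hy
  have hflip : ContDiffAt ℝ ∞ (fun z => (fderiv ℝ G z).flip) y :=
    (ContinuousLinearMap.flipₗᵢ ℝ E E (E →L[ℝ] ℝ)).contDiff.contDiffAt.comp y h
  exact ((h.add hflip).sub (contDiffAt_const.clm_comp hflip)).const_smul (1 / 2 : ℝ)

variable [FiniteDimensional ℝ E]

theorem contDiffAt_inverse : ContDiffAt ℝ ∞ (fun z => (G z).inverse) y := by
  have := FiniteDimensional.complete ℝ E
  exact ((hG.isInvertible y hy).contDiffAt_map_inverse).comp y (hG.contDiffAt hy)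

theorem contDiffAt_christoffel : ContDiffAt ℝ ∞ (christoffel G) y :=
  ((ContinuousLinearMap.compL ℝ E (E →L[ℝ] ℝ) E).contDiff.contDiffAt.comp y
    (hG.contDiffAt_inverse hy)).clm_comp (hG.contDiffAt_christoffelFst hy)

theorem differentiableAt_christoffel : DifferentiableAt ℝ (christoffel G) y :=
  (hG.contDiffAt_christoffel hy).differentiableAt (by simp)

theorem fderiv_fderiv_eq (u v w z : E) :
    fderiv ℝ (fderiv ℝ G) y u v w z =
      fderiv ℝ G y u (christoffel G y v w) z + G y (fderiv ℝ (christoffel G) y u v w) z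
      + fderiv ℝ G y u w (christoffel G y v z) + G y w (fderiv ℝ (christoffel G) y u v z) := by
  have hD : DifferentiableAt ℝ (fderiv ℝ G) y :=
    (hG.contDiffAt_fderiv hy).differentiableAt (by simp)
  have h0 := (hasFDerivAt_apply_apply hD v w).clm_apply (hasFDerivAt_const z y)
  have hΓ := hG.differentiableAt_christoffel hy
  have h1 := ((hG.differentiableAt hy).hasFDerivAt.clm_apply
    (hasFDerivAt_apply_apply hΓ v w)).clm_apply (hasFDerivAt_const z y)
  have h2 := ((hG.differentiableAt hy).hasFDerivAt.clm_apply
    (hasFDerivAt_const w y)).clm_apply (hasFDerivAt_apply_apply hΓ v z)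
  have h3 : (fun x => fderiv ℝ G x v w z) =ᶠ[𝓝 y]
      fun x => G x (christoffel G x v w) z + G x w (christoffel G x v z) := by
    filter_upwards [hG.mem_nhds hy] with x hx using hG.fderiv_eq hx v w z
  have := DFunLike.congr_fun (h0.unique ((h1.add h2).congr_of_eventuallyEq h3)) u
  simp at this
  rw [this]
  ring

theorem apply_riemann_skew (u v w z : E) :
    G y (riemann G y u v w) z + G y w (riemann G y u v z) = 0 := by
  have hs : fderiv ℝ (fderiv ℝ G) y u v = fderiv ℝ (fderiv ℝ G) y v u :=
    ((hG.contDiffAt hy).isSymmSndFDerivAt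
      (by simpa using WithTop.coe_le_coe.2 (le_top : (2 : ℕ∞) ≤ ⊤))).eq u v
  have h : fderiv ℝ (fderiv ℝ G) y u v w z = fderiv ℝ (fderiv ℝ G) y v u w z := by rw [hs]
  simp only [hG.fderiv_fderiv_eq hy, hG.fderiv_eq hy] at h
  simp only [riemann_apply, map_add, map_sub, add_apply,
    sub_apply]
  rw [hG.symm y hy (christoffel G y u w)] at h
  linarith

end IsMetricOn

theorem riemann_swap (G : E → (E →L[ℝ] E →L[ℝ] ℝ)) (y u v w : E) :
    riemann G y v u w = - riemann G y u v w := by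
  simp only [riemann_apply]
  abel

section Surface

theorem skew_coefficients {p q r α β γ δ : ℝ} (hdet : p * r - q ^ 2 ≠ 0) (h0 : α * p + γ * q = 0)
    (h1 : β * q + δ * r = 0) (h2 : α * q + γ * r + (β * p + δ * q) = 0) :
    -γ = -(α * q + γ * r) / (p * r - q ^ 2) * p ∧ -δ = -(α * q + γ * r) / (p * r - q ^ 2) * q ∧
      α = -(α * q + γ * r) / (p * r - q ^ 2) * q ∧ β = -(α * q + γ * r) / (p * r - q ^ 2) * r := by
  refine ⟨?_, ?_, ?_, ?_⟩ <;> rw [div_mul_eq_mul_div, eq_div_iff hdet]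
  · linear_combination q * h0
  · linear_combination q * h2 - p * h1
  · linear_combination r * h0
  · linear_combination r * h2 - q * h1

variable (b : Module.Basis (Fin 2) ℝ E)

theorem trace_fin_two (T : E →ₗ[ℝ] E) :
    LinearMap.trace ℝ E T = b.repr (T (b 0)) 0 + b.repr (T (b 1)) 1 := by
  rw [LinearMap.trace_eq_matrix_trace ℝ b, Matrix.trace_fin_two]
  simp [LinearMap.toMatrix_apply]

variable [FiniteDimensional ℝ E]

theorem ricci_basis_zero (G : E → (E →L[ℝ] E →L[ℝ] ℝ)) (y w : E) :
    ricci G y (b 0) w = - b.repr (riemann G y (b 0) (b 1) w) 1 := by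
  have h0 : riemann G y (b 0) (b 0) w = 0 := by simp [riemann_apply]
  rw [ricci_apply, trace_fin_two b]
  simp [h0, riemann_swap G y (b 0) (b 1)]

theorem ricci_basis_one (G : E → (E →L[ℝ] E →L[ℝ] ℝ)) (y w : E) :
    ricci G y (b 1) w = b.repr (riemann G y (b 0) (b 1) w) 0 := by
  have h0 : riemann G y (b 1) (b 1) w = 0 := by simp [riemann_apply]
  rw [ricci_apply, trace_fin_two b]
  simp [h0]

include b in
theorem riemann_eq_zero_of_ricci_eq_zero {G : E → (E →L[ℝ] E →L[ℝ] ℝ)} {y : E}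
    (h : ricci G y = 0) : riemann G y = 0 := by
  have h01 : ∀ w, riemann G y (b 0) (b 1) w = 0 := fun w => by
    refine b.repr.map_eq_zero_iff.1 (Finsupp.ext fun i => ?_)
    have h0 := ricci_basis_zero b G y w
    have h1 := ricci_basis_one b G y w
    rw [h] at h0 h1
    fin_cases i
    · simpa using h1.symm
    · simpa using h0.symm
  have hself : ∀ u w, riemann G y u u w = 0 := fun u w => by simp [riemann_apply]
  ext u v w
  rw [← b.sum_repr u, ← b.sum_repr v]
  simp only [Fin.sum_univ_two, map_add, map_smul, add_apply, smul_apply, h01, hself,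
    riemann_swap G y (b 0) (b 1)]
  simp

include b in
/-- On a surface, the Ricci curvature is half the scalar curvature times the metric. -/
theorem IsMetricOn.ricci_eq_half_scalar_smul {G : E → (E →L[ℝ] E →L[ℝ] ℝ)} {U : Set E}
    (hG : IsMetricOn G U) {y : E} (hy : y ∈ U) : ricci G y = (scalar G y / 2) • G y := by
  obtain ⟨k, hk⟩ : ∃ k : ℝ, ricci G y = k • G y := by
    set A : E → E := fun w => riemann G y (b 0) (b 1) w
    have hrepr : ∀ w, A w = b.repr (A w) 0 • b 0 + b.repr (A w) 1 • b 1 := fun w => by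
      conv_lhs => rw [← b.sum_repr (A w)]
      rw [Fin.sum_univ_two]
    have hexp : ∀ w z, G y (A w) z = b.repr (A w) 0 * G y (b 0) z + b.repr (A w) 1 * G y (b 1) z :=
      fun w z => by
        conv_lhs => rw [hrepr w]
        simp
    have s00 := hG.apply_riemann_skew hy (b 0) (b 1) (b 0) (b 0)
    have s11 := hG.apply_riemann_skew hy (b 0) (b 1) (b 1) (b 1)
    have s01 := hG.apply_riemann_skew hy (b 0) (b 1) (b 0) (b 1)
    rw [hG.symm y hy (b 0)] at s00 s01
    rw [hG.symm y hy (b 1)] at s11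
    change G y (A (b 0)) (b 0) + G y (A (b 0)) (b 0) = 0 at s00
    change G y (A (b 0)) (b 1) + G y (A (b 1)) (b 0) = 0 at s01
    change G y (A (b 1)) (b 1) + G y (A (b 1)) (b 1) = 0 at s11
    rw [hexp] at s00 s11
    rw [hexp, hexp] at s01
    have r0 : ∀ w, ricci G y (b 0) w = - b.repr (A w) 1 := ricci_basis_zero b G y
    have r1 : ∀ w, ricci G y (b 1) w = b.repr (A w) 0 := ricci_basis_one b G y
    have hsym : G y (b 1) (b 0) = G y (b 0) (b 1) := hG.symm y hy _ _
    rw [hsym] at s00 s01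
    set p := G y (b 0) (b 0) with hp
    set q := G y (b 0) (b 1) with hq
    set r := G y (b 1) (b 1) with hr
    have hdet : p * r - q ^ 2 ≠ 0 := fun hdet => by
      have hinj : ∀ s t : ℝ, s * p + t * q = 0 → s * q + t * r = 0 → s = 0 ∧ t = 0 := by
        intro s t h0 h1
        have : s • b 0 + t • b 1 = 0 := by
          refine eq_of_forall_apply_eq (hG.isInvertible y hy) fun z => ?_
          rw [← b.sum_repr z]
          simp only [Fin.sum_univ_two, map_add, map_smul, add_apply,
            smul_apply, smul_eq_mul, map_zero, zero_apply,
            hsym, ← hp, ← hq, ← hr]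
          linear_combination b.repr z 0 * h0 + b.repr z 1 * h1
        have h := congrArg b.repr this
        exact ⟨by simpa using DFunLike.congr_fun h 0, by simpa using DFunLike.congr_fun h 1⟩
      obtain ⟨hr0, hq0⟩ := hinj r (-q) (by linear_combination hdet) (by ring)
      obtain ⟨-, hp0⟩ := hinj q (-p) (by ring) (by linear_combination -hdet)
      obtain ⟨h1, -⟩ := hinj 1 0 (by linarith) (by linarith)
      exact one_ne_zero h1
    refine ⟨-(b.repr (A (b 0)) 0 * q + b.repr (A (b 0)) 1 * r) / (p * r - q ^ 2), ?_⟩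
    set α := b.repr (A (b 0)) 0
    set γ := b.repr (A (b 0)) 1
    set β := b.repr (A (b 1)) 0
    set δ := b.repr (A (b 1)) 1
    obtain ⟨h00, h01, h10, h11⟩ := skew_coefficients (α := α) (β := β) (γ := γ) (δ := δ) hdet
      (by linear_combination s00 / 2) (by linear_combination s11 / 2) s01
    replace h00 := (r0 (b 0)).trans h00
    replace h01 := (r0 (b 1)).trans h01
    replace h10 := (r1 (b 0)).trans h10
    replace h11 := (r1 (b 1)).trans h11
    ext u v
    rw [← b.sum_repr u, ← b.sum_repr v]
    simp only [Fin.sum_univ_two, map_add, map_smul, add_apply,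
            smul_apply, smul_eq_mul, hsym, h00, h01, h10, h11,
            ← hp, ← hq, ← hr]
  have hs : scalar G y = 2 * k := by
    have : ((G y).inverse.comp (ricci G y) : E →ₗ[ℝ] E) = k • LinearMap.id := by
      ext u
      refine eq_of_forall_apply_eq (hG.isInvertible y hy) fun z => ?_
      simp [hk, apply_inverse_apply (hG.isInvertible y hy)]
    rw [scalar, this, map_smul, LinearMap.trace_id, Module.finrank_eq_card_basis b]
    simp [mul_comm]
  rw [hk, hs]
  simp

end Surface

theorem isInvertible_of_nondegenerate [FiniteDimensional ℝ E] {g : E →L[ℝ] E →L[ℝ] ℝ}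
    (hg : ∀ v, (∀ w, g v w = 0) → v = 0) : g.IsInvertible := by
  let e : (E →L[ℝ] ℝ) ≃ₗ[ℝ] Module.Dual ℝ E := LinearMap.toContinuousLinearMap.symm
  have hinj : Function.Injective (g : E →ₗ[ℝ] E →L[ℝ] ℝ) :=
    (injective_iff_map_eq_zero _).2 fun v hv => hg v fun w => DFunLike.congr_fun hv w
  have hrank : Module.finrank ℝ E = Module.finrank ℝ (E →L[ℝ] ℝ) :=
    Subspace.dual_finrank_eq.symm.trans e.finrank_eq.symm
  exact ⟨(LinearEquiv.ofInjectiveOfFinrankEq _ hinj hrank).toContinuousLinearEquiv, rfl⟩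

/-- The covariant derivative of the gradient of `φ`. -/
def covGrad (G : E → (E →L[ℝ] E →L[ℝ] ℝ)) (φ : E → ℝ) (y : E) : E →L[ℝ] E :=
  fderiv ℝ (grad G φ) y + (christoffel G y).flip (grad G φ y)

theorem covGrad_apply (G : E → (E →L[ℝ] E →L[ℝ] ℝ)) (φ : E → ℝ) (y u : E) :
    covGrad G φ y u = fderiv ℝ (grad G φ) y u + christoffel G y u (grad G φ y) := rfl

namespace IsMetricOn

variable {G : E → (E →L[ℝ] E →L[ℝ] ℝ)} {U : Set E} (hG : IsMetricOn G U) {y : E} (hy : y ∈ U)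
  {φ : E → ℝ} (hφ : ContDiffOn ℝ ∞ φ U)

include hG hy

theorem apply_grad : G y (grad G φ y) = fderiv ℝ φ y :=
  apply_inverse_apply (hG.isInvertible y hy) _

include hφ

theorem contDiffAt_fderiv_of_contDiffOn : ContDiffAt ℝ ∞ (fderiv ℝ φ) y :=
  (hφ.contDiffAt (hG.mem_nhds hy)).fderiv_right (by simp)

theorem differentiableAt_of_contDiffOn : DifferentiableAt ℝ φ y :=
  (hφ.contDiffAt (hG.mem_nhds hy)).differentiableAt (by simp)

theorem differentiableAt_fderiv_of_contDiffOn : DifferentiableAt ℝ (fderiv ℝ φ) y :=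
  (hG.contDiffAt_fderiv_of_contDiffOn hy hφ).differentiableAt (by simp)

theorem fderiv_inv_smul_fderiv (h0 : φ y ≠ 0) (u v : E) :
    fderiv ℝ (fun z => (φ z)⁻¹ • fderiv ℝ φ z) y u v =
      (φ y)⁻¹ * fderiv ℝ (fderiv ℝ φ) y u v
        - (φ y)⁻¹ * fderiv ℝ φ y u * ((φ y)⁻¹ * fderiv ℝ φ y v) := by
  have hd := hG.differentiableAt_of_contDiffOn hy hφ
  have h1 : HasFDerivAt (fun z => (φ z)⁻¹) _ y :=
    (hasDerivAt_inv h0).comp_hasFDerivAt y hd.hasFDerivAt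
  have h2 := h1.smul (hG.differentiableAt_fderiv_of_contDiffOn hy hφ).hasFDerivAt
  have h3 : fderiv ℝ (fun z => (φ z)⁻¹ • fderiv ℝ φ z) y = _ := h2.fderiv
  rw [h3]
  simp
  field_simp
  ring

variable [FiniteDimensional ℝ E]

theorem differentiableAt_grad : DifferentiableAt ℝ (grad G φ) y :=
  ((hG.contDiffAt_inverse hy).clm_apply
    (hG.contDiffAt_fderiv_of_contDiffOn hy hφ)).differentiableAt (by simp)

theorem fderiv_smul_grad (u : E) :
    fderiv ℝ (φ • grad G φ) y u =
      φ y • fderiv ℝ (grad G φ) y u + fderiv ℝ φ y u • grad G φ y := by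
  rw [fderiv_smul (hG.differentiableAt_of_contDiffOn hy hφ) (hG.differentiableAt_grad hy hφ)]
  simp

theorem apply_covGrad (u w : E) : G y (covGrad G φ y u) w = hess G φ y u w := by
  have h1 := ((hG.differentiableAt hy).hasFDerivAt.clm_apply
    (hG.differentiableAt_grad hy hφ).hasFDerivAt)
  have h2 := (hG.differentiableAt_fderiv_of_contDiffOn hy hφ).hasFDerivAt
  have h3 : (fun z => G z (grad G φ z)) =ᶠ[𝓝 y] fderiv ℝ φ := by
    filter_upwards [hG.mem_nhds hy] with z hz using hG.apply_grad hz
  have h := DFunLike.congr_fun (DFunLike.congr_fun (h1.unique (h2.congr_of_eventuallyEq h3)) u) w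
  have h4 : G y (grad G φ y) (christoffel G y u w) = fderiv ℝ φ y (christoffel G y u w) := by
    rw [hG.apply_grad hy]
  simp [hG.fderiv_eq hy, h4] at h
  rw [covGrad_apply, hess, ← h, map_add, add_apply]
  ring

theorem hasFDerivAt_normSq_grad :
    HasFDerivAt (fun z => fderiv ℝ φ z (grad G φ z))
      ((2 : ℝ) • (G y (grad G φ y)).comp (covGrad G φ y)) y := by
  have h1 := (hG.differentiableAt_fderiv_of_contDiffOn hy hφ).hasFDerivAt.clm_apply
    (hG.differentiableAt_grad hy hφ).hasFDerivAt
  refine h1.congr_fderiv ?_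
  refine ContinuousLinearMap.ext fun u => ?_
  have h2 := hG.apply_covGrad hy hφ u (grad G φ y)
  rw [hG.symm y hy, hess] at h2
  have h3 := congrArg (G y (grad G φ y)) (covGrad_apply G φ y u)
  simp only [map_add, hG.apply_grad hy] at h2 h3 ⊢
  simp
  linarith

/-- A positive solution of `Hess φ = (c / 4) φ² G` with `(c / 2) φ³ + |∇φ|²` constant forces
`c = 0`. -/
theorem eq_zero_of_hess_eq [Nontrivial E] {c μ : ℝ} (hpos : ∀ z ∈ U, 0 < φ z)
    (hhess : ∀ z ∈ U, ∀ u v, hess G φ z u v = c / 4 * φ z ^ 2 * G z u v)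
    (hconst : ∀ z ∈ U, c / 2 * φ z ^ 3 + fderiv ℝ φ z (grad G φ z) = μ) : c = 0 := by
  by_contra hc
  have hfd : ∀ z ∈ U, fderiv ℝ φ z = 0 := fun z hz => by
    have h1 := ((hG.differentiableAt_of_contDiffOn hz hφ).hasFDerivAt.pow 3).const_mul (c / 2)
    have h2 := hG.hasFDerivAt_normSq_grad hz hφ
    have h3 : (fun x => c / 2 * φ x ^ 3 + fderiv ℝ φ x (grad G φ x)) =ᶠ[𝓝 z] fun _ => μ := by
      filter_upwards [hG.mem_nhds hz] with x hx using hconst x hx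
    refine ContinuousLinearMap.ext fun u => ?_
    have h4 := DFunLike.congr_fun
      ((h1.add h2).unique ((hasFDerivAt_const μ z).congr_of_eventuallyEq h3)) u
    have h5 := hG.apply_covGrad hz hφ u (grad G φ z)
    rw [hG.symm z hz, hhess z hz, hG.symm z hz u] at h5
    simp only [hG.apply_grad hz] at h5 h4
    simp [h5] at h4
    have h6 : 2 * c * φ z ^ 2 * fderiv ℝ φ z u = 0 := by linear_combination h4
    have := (hpos z hz).ne'
    simpa [hc, this] using h6
  have hfd2 : fderiv ℝ (fderiv ℝ φ) y = 0 := by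
    have : fderiv ℝ φ =ᶠ[𝓝 y] fun _ => 0 := by
      filter_upwards [hG.mem_nhds hy] with x hx using hfd x hx
    rw [this.fderiv_eq]
    simp
  obtain ⟨v, hv⟩ := exists_ne (0 : E)
  refine hv (eq_of_forall_apply_eq (hG.isInvertible y hy) fun w => ?_)
  have h := hhess y hy v w
  have := (hpos y hy).ne'
  simpa [hess, hfd y hy, hfd2, hc, this] using h.symm

end IsMetricOn

section Warped

variable {E : Type*} [NormedAddCommGroup E] [NormedSpace ℝ E]
  {E' : Type*} [NormedAddCommGroup E'] [NormedSpace ℝ E']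

theorem trace_prod_eq [FiniteDimensional ℝ E] [FiniteDimensional ℝ E']
    (T : E × E' →ₗ[ℝ] E × E') :
    LinearMap.trace ℝ (E × E') T =
      LinearMap.trace ℝ E (LinearMap.fst ℝ E E' ∘ₗ T ∘ₗ LinearMap.inl ℝ E E')
      + LinearMap.trace ℝ E' (LinearMap.snd ℝ E E' ∘ₗ T ∘ₗ LinearMap.inr ℝ E E') := by
  have h : T = LinearMap.inl ℝ E E' ∘ₗ (LinearMap.fst ℝ E E' ∘ₗ T)
      + LinearMap.inr ℝ E E' ∘ₗ (LinearMap.snd ℝ E E' ∘ₗ T) := by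
    ext <;> simp
  conv_lhs => rw [h]
  rw [map_add]
  exact congrArg₂ (· + ·) (LinearMap.trace_comp_comm' ..) (LinearMap.trace_comp_comm' ..)

theorem hasFDerivAt_comp_fst {N : Type*} [NormedAddCommGroup N] [NormedSpace ℝ N] {p : E → N}
    {p' : E →L[ℝ] N} {x : E} (hp : HasFDerivAt p p' x) (y : E') :
    HasFDerivAt (fun z : E × E' => p z.1) (p'.comp (ContinuousLinearMap.fst ℝ E E')) (x, y) :=
  HasFDerivAt.comp (g := p) (x, y) hp hasFDerivAt_fst

theorem hasFDerivAt_comp_snd {N : Type*} [NormedAddCommGroup N] [NormedSpace ℝ N] {p : E' → N}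
    {p' : E' →L[ℝ] N} {y : E'} (hp : HasFDerivAt p p' y) (x : E) :
    HasFDerivAt (fun z : E × E' => p z.2) (p'.comp (ContinuousLinearMap.snd ℝ E E')) (x, y) :=
  HasFDerivAt.comp (g := p) (x, y) hp hasFDerivAt_snd

/-- The warped product metric `G + φ² H` on a product of vector spaces. -/
def warped (G : E → (E →L[ℝ] E →L[ℝ] ℝ)) (φ : E → ℝ) (H : E' → (E' →L[ℝ] E' →L[ℝ] ℝ))
    (z : E × E') : E × E' →L[ℝ] E × E' →L[ℝ] ℝ :=
  (ContinuousLinearMap.precomp ℝ (ContinuousLinearMap.fst ℝ E E')).comp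
      ((G z.1).comp (ContinuousLinearMap.fst ℝ E E'))
    + (φ z.1) ^ 2 • (ContinuousLinearMap.precomp ℝ (ContinuousLinearMap.snd ℝ E E')).comp
      ((H z.2).comp (ContinuousLinearMap.snd ℝ E E'))

theorem warped_apply (G : E → (E →L[ℝ] E →L[ℝ] ℝ)) (φ : E → ℝ) (H : E' → (E' →L[ℝ] E' →L[ℝ] ℝ))
    (z v w : E × E') : warped G φ H z v w = G z.1 v.1 w.1 + φ z.1 ^ 2 * H z.2 v.2 w.2 := rfl

variable {G : E → (E →L[ℝ] E →L[ℝ] ℝ)} {U : Set E} (hG : IsMetricOn G U)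
  {H : E' → (E' →L[ℝ] E' →L[ℝ] ℝ)} {V : Set E'} (hH : IsMetricOn H V)
  {φ : E → ℝ} (hφ : ContDiffOn ℝ ∞ φ U) (hpos : ∀ x ∈ U, 0 < φ x)

namespace IsMetricOn

include hG hH hφ hpos in
theorem warped [FiniteDimensional ℝ E] [FiniteDimensional ℝ E'] :
    IsMetricOn (warped G φ H) (U ×ˢ V) where
  isOpen := hG.isOpen.prod hH.isOpen
  contDiffOn := by
    have h1 : ContDiffOn ℝ ∞ (fun z : E × E' => G z.1) (U ×ˢ V) :=
      hG.contDiffOn.comp contDiffOn_fst fun z hz => hz.1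
    have h2 : ContDiffOn ℝ ∞ (fun z : E × E' => H z.2) (U ×ˢ V) :=
      hH.contDiffOn.comp contDiffOn_snd fun z hz => hz.2
    have h3 : ContDiffOn ℝ ∞ (fun z : E × E' => φ z.1) (U ×ˢ V) :=
      hφ.comp contDiffOn_fst fun z hz => hz.1
    exact (contDiffOn_const.clm_comp (h1.clm_comp contDiffOn_const)).add
      ((h3.pow 2).smul (contDiffOn_const.clm_comp (h2.clm_comp contDiffOn_const)))
  symm z hz v w := by
    rw [warped_apply, warped_apply, hG.symm _ hz.1, hH.symm _ hz.2]
  isInvertible z hz := by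
    refine isInvertible_of_nondegenerate fun v hv => Prod.ext ?_ ?_
    · refine eq_of_forall_apply_eq (hG.isInvertible _ hz.1) fun w => ?_
      simpa [warped_apply] using hv (w, 0)
    · refine eq_of_forall_apply_eq (hH.isInvertible _ hz.2) fun w => ?_
      simpa [warped_apply, (hpos _ hz.1).ne'] using hv (0, w)

end IsMetricOn

variable [FiniteDimensional ℝ E] [FiniteDimensional ℝ E'] {x : E} (hx : x ∈ U) {y : E'} (hy : y ∈ V)

include hG hH hφ hpos hx hy

theorem fderiv_warped (u v w : E × E') :
    fderiv ℝ (warped G φ H) (x, y) u v w =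
      fderiv ℝ G x u.1 v.1 w.1 + 2 * φ x * fderiv ℝ φ x u.1 * H y v.2 w.2
        + φ x ^ 2 * fderiv ℝ H y u.2 v.2 w.2 := by
  have h0 := hasFDerivAt_apply_apply ((hG.warped hH hφ hpos).differentiableAt (mk_mem_prod hx hy))
    v w
  have h1 := hasFDerivAt_comp_fst (hasFDerivAt_apply_apply (hG.differentiableAt hx) v.1 w.1) y
  have h2 := hasFDerivAt_comp_snd (hasFDerivAt_apply_apply (hH.differentiableAt hy) v.2 w.2) x
  have h3 := hasFDerivAt_comp_fst (hG.differentiableAt_of_contDiffOn hx hφ).hasFDerivAt y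
  have h4 := h1.add ((h3.pow 2).mul h2)
  have h := DFunLike.congr_fun (h0.unique h4) u
  simp at h
  rw [h]
  ring

theorem christoffel_warped (u v : E × E') :
    christoffel (warped G φ H) (x, y) u v =
      (christoffel G x u.1 v.1 - H y u.2 v.2 • φ x • grad G φ x,
        christoffel H y u.2 v.2 + ((φ x)⁻¹ • fderiv ℝ φ x) u.1 • v.2
          + ((φ x)⁻¹ • fderiv ℝ φ x) v.1 • u.2) := by
  have hW := hG.warped hH hφ hpos
  have hxy : (x, y) ∈ U ×ˢ V := mk_mem_prod hx hy
  have hφx := (hpos x hx).ne'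
  refine eq_of_forall_apply_eq (hW.isInvertible _ hxy) fun w => ?_
  rw [hW.apply_christoffel hxy, warped_apply]
  simp only [fderiv_warped hG hH hφ hpos hx hy, map_sub, map_add, map_smul, sub_apply, add_apply,
    smul_apply, hG.apply_christoffel hx, hH.apply_christoffel hy, hG.apply_grad hx, smul_eq_mul]
  rw [hH.symm y hy u.2 w.2, hH.symm y hy v.2 w.2, hH.symm y hy w.2 u.2, hH.symm y hy w.2 v.2]
  field_simp
  ring

theorem fderiv_christoffel_warped (u v w : E × E') :
    fderiv ℝ (christoffel (warped G φ H)) (x, y) u v w =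
      (fderiv ℝ (christoffel G) x u.1 v.1 w.1
          - (H y v.2 w.2 • fderiv ℝ (φ • grad G φ) x u.1
            + fderiv ℝ H y u.2 v.2 w.2 • φ x • grad G φ x),
        fderiv ℝ (christoffel H) y u.2 v.2 w.2
          + fderiv ℝ (fun z => (φ z)⁻¹ • fderiv ℝ φ z) x u.1 v.1 • w.2
          + fderiv ℝ (fun z => (φ z)⁻¹ • fderiv ℝ φ z) x u.1 w.1 • v.2) := by
  have hW := hG.warped hH hφ hpos
  have hxy : (x, y) ∈ U ×ˢ V := mk_mem_prod hx hy
  have h0 := hasFDerivAt_apply_apply (hW.differentiableAt_christoffel hxy) v w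
  have h1 := hasFDerivAt_comp_fst
    (hasFDerivAt_apply_apply (hG.differentiableAt_christoffel hx) v.1 w.1) y
  have h2 := hasFDerivAt_comp_snd
    (hasFDerivAt_apply_apply (hH.differentiableAt_christoffel hy) v.2 w.2) x
  have h3 := hasFDerivAt_comp_snd (hasFDerivAt_apply_apply (hH.differentiableAt hy) v.2 w.2) x
  have hd := hG.differentiableAt_of_contDiffOn hx hφ
  have h4 := hasFDerivAt_comp_fst (hd.smul (hG.differentiableAt_grad hx hφ)).hasFDerivAt y
  have hθ : DifferentiableAt ℝ (fun z => (φ z)⁻¹ • fderiv ℝ φ z) x :=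
    (hd.inv (hpos x hx).ne').smul (hG.differentiableAt_fderiv_of_contDiffOn hx hφ)
  have h5 (a : E) := hasFDerivAt_comp_fst (hθ.hasFDerivAt.clm_apply (hasFDerivAt_const a x)) y
  have h6 := (h1.sub (h3.smul h4)).prodMk
    ((h2.add ((h5 v.1).smul_const w.2)).add ((h5 w.1).smul_const v.2))
  have h7 := h6.congr_of_eventuallyEq (f₁ := fun z => christoffel (warped G φ H) z v w) (by
    filter_upwards [hW.mem_nhds hxy] with z hz using
      christoffel_warped hG hH hφ hpos hz.1 hz.2 v w)
  have h := DFunLike.congr_fun (h0.unique h7) u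
  simp only [ContinuousLinearMap.flip_apply] at h
  rw [h]
  refine Prod.ext ?_ ?_ <;> simp

theorem riemann_warped_fst_fst (u v w : E) :
    (riemann (warped G φ H) (x, y) (u, 0) (v, 0) (w, 0)).1 = riemann G x u v w := by
  simp [riemann_apply, fderiv_christoffel_warped hG hH hφ hpos hx hy,
    christoffel_warped hG hH hφ hpos hx hy]

theorem riemann_warped_snd_fst (d : E') (v w : E) :
    (riemann (warped G φ H) (x, y) (0, d) (v, 0) (w, 0)).2 = (-((φ x)⁻¹ * hess G φ x v w)) • d := by
  simp [riemann_apply, fderiv_christoffel_warped hG hH hφ hpos hx hy,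
    christoffel_warped hG hH hφ hpos hx hy, hG.fderiv_inv_smul_fderiv hx hφ (hpos x hx).ne', hess]
  module

theorem riemann_warped_fst_snd (u : E) (a b : E') :
    (riemann (warped G φ H) (x, y) (u, 0) (0, a) (0, b)).1 =
      (-(H y a b * φ x)) • covGrad G φ x u := by
  have := (hpos x hx).ne'
  simp [riemann_apply, fderiv_christoffel_warped hG hH hφ hpos hx hy,
    christoffel_warped hG hH hφ hpos hx hy, hG.fderiv_smul_grad hx hφ, covGrad_apply]
  match_scalars <;> field_simp <;> ring

theorem riemann_warped_snd_snd (d a b : E') :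
    (riemann (warped G φ H) (x, y) (0, d) (0, a) (0, b)).2 =
      riemann H y d a b + fderiv ℝ φ x (grad G φ x) • (H y d b • a - H y a b • d) := by
  have := (hpos x hx).ne'
  simp [riemann_apply, fderiv_christoffel_warped hG hH hφ hpos hx hy,
    christoffel_warped hG hH hφ hpos hx hy]
  match_scalars <;> field_simp

theorem ricci_warped_fst (v w : E) :
    ricci (warped G φ H) (x, y) (v, 0) (w, 0) =
      ricci G x v w - Module.finrank ℝ E' * (φ x)⁻¹ * hess G φ x v w := by
  rw [ricci_apply, trace_prod_eq, sub_eq_add_neg]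
  congr 1
  · rw [ricci_apply]
    congr 1
    ext u
    exact riemann_warped_fst_fst hG hH hφ hpos hx hy u v w
  · have : LinearMap.snd ℝ E E' ∘ₗ
        ((((riemann (warped G φ H) (x, y)).flip (v, 0)).flip (w, 0) : E × E' →L[ℝ] E × E') :
          E × E' →ₗ[ℝ] E × E') ∘ₗ LinearMap.inr ℝ E E' =
        (-((φ x)⁻¹ * hess G φ x v w)) • LinearMap.id := by
      ext d
      exact riemann_warped_snd_fst hG hH hφ hpos hx hy d v w
    rw [this, map_smul, LinearMap.trace_id, smul_eq_mul]
    ring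

theorem ricci_warped_snd (a b : E') :
    ricci (warped G φ H) (x, y) (0, a) (0, b) =
      ricci H y a b - H y a b * (φ x * LinearMap.trace ℝ E (covGrad G φ x : E →L[ℝ] E)
        + (Module.finrank ℝ E' - 1) * fderiv ℝ φ x (grad G φ x)) := by
  have h1 : LinearMap.fst ℝ E E' ∘ₗ
        ((((riemann (warped G φ H) (x, y)).flip (0, a)).flip (0, b) : E × E' →L[ℝ] E × E') :
          E × E' →ₗ[ℝ] E × E') ∘ₗ LinearMap.inl ℝ E E' =
        (-(H y a b * φ x)) • (covGrad G φ x : E →ₗ[ℝ] E) := by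
    ext u
    exact riemann_warped_fst_snd hG hH hφ hpos hx hy u a b
  have h2 : LinearMap.snd ℝ E E' ∘ₗ
        ((((riemann (warped G φ H) (x, y)).flip (0, a)).flip (0, b) : E × E' →L[ℝ] E × E') :
          E × E' →ₗ[ℝ] E × E') ∘ₗ LinearMap.inr ℝ E E' =
        ((((riemann H y).flip a).flip b : E' →L[ℝ] E') : E' →ₗ[ℝ] E') +
          fderiv ℝ φ x (grad G φ x) •
            (((H y b : E' →L[ℝ] ℝ) : E' →ₗ[ℝ] ℝ).smulRight a - H y a b • LinearMap.id) := by
    ext d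
    refine (riemann_warped_snd_snd hG hH hφ hpos hx hy d a b).trans ?_
    simp [hH.symm y hy d b]
  rw [ricci_apply, trace_prod_eq, h1, h2, ricci_apply]
  simp only [map_add, map_sub, map_smul, LinearMap.trace_id, LinearMap.trace_smulRight, smul_eq_mul]
  simp [hH.symm y hy b a]
  ring

end Warped

section Congr

variable {E : Type*} [NormedAddCommGroup E] [NormedSpace ℝ E]
  {G G' : E → (E →L[ℝ] E →L[ℝ] ℝ)} {y : E}

theorem christoffel_congr (h : G =ᶠ[𝓝 y] G') : christoffel G y = christoffel G' y := by
  ext u v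
  rw [christoffel_apply, christoffel_apply, h.eq_of_nhds]
  congr 1
  ext w
  rw [christoffelFst_apply, christoffelFst_apply, h.fderiv_eq]

theorem riemann_congr (h : G =ᶠ[𝓝 y] G') : riemann G y = riemann G' y := by
  have hΓ : christoffel G =ᶠ[𝓝 y] christoffel G' :=
    h.eventuallyEq_nhds.mono fun _ hz => christoffel_congr hz
  rw [riemann, riemann, hΓ.fderiv_eq, hΓ.eq_of_nhds]

theorem ricci_congr [FiniteDimensional ℝ E] (h : G =ᶠ[𝓝 y] G') : ricci G y = ricci G' y := by
  ext v w
  rw [ricci_apply, ricci_apply, riemann_congr h]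

end Congr

variable {E : Type*} [NormedAddCommGroup E] [NormedSpace ℝ E] [FiniteDimensional ℝ E]
  {E' : Type*} [NormedAddCommGroup E'] [NormedSpace ℝ E'] [FiniteDimensional ℝ E']

theorem riemann_eq_zero_and_hess_eq_zero (b : Module.Basis (Fin 2) ℝ E)
    (b' : Module.Basis (Fin 2) ℝ E') {G : E → (E →L[ℝ] E →L[ℝ] ℝ)} {U : Set E}
    (hG : IsMetricOn G U) {H : E' → (E' →L[ℝ] E' →L[ℝ] ℝ)} {V : Set E'} (hH : IsMetricOn H V)
    {φ : E → ℝ} (hφ : ContDiffOn ℝ ∞ φ U) (hpos : ∀ x ∈ U, 0 < φ x) {c μ : ℝ}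
    (hc : ∀ x ∈ U, scalar G x = c * φ x) {y : E'} (hy : y ∈ V) (hμ : ricci H y = μ • H y)
    (hW : ∀ x ∈ U, ricci (warped G φ H) (x, y) = 0) {x : E} (hx : x ∈ U) :
    riemann G x = 0 ∧ ∀ u v, hess G φ x u v = 0 := by
  have hE : Module.finrank ℝ E = 2 := by simp [Module.finrank_eq_card_basis b]
  have hE' : Module.finrank ℝ E' = 2 := by simp [Module.finrank_eq_card_basis b']
  have : Nontrivial E := ⟨⟨b 0, 0, b.ne_zero 0⟩⟩
  have hhess : ∀ x ∈ U, ∀ u v, hess G φ x u v = c / 4 * φ x ^ 2 * G x u v := by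
    intro x hx u v
    have h := ricci_warped_fst hG hH hφ hpos hx hy u v
    rw [hW x hx, hG.ricci_eq_half_scalar_smul b hx, hc x hx, hE'] at h
    have := (hpos x hx).ne'
    simp at h
    field_simp at h
    linear_combination h / 4
  have hcov : ∀ x ∈ U, covGrad G φ x = (c / 4 * φ x ^ 2) • ContinuousLinearMap.id ℝ E := by
    intro x hx
    ext u
    refine eq_of_forall_apply_eq (hG.isInvertible x hx) fun w => ?_
    rw [hG.apply_covGrad hx hφ, hhess x hx]
    simp
  obtain ⟨a, a', ha⟩ : ∃ a a', H y a a' ≠ 0 := by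
    by_contra! h
    refine b'.ne_zero 0 (eq_of_forall_apply_eq (hH.isInvertible y hy) fun w => ?_)
    rw [h, h]
  have hconst : ∀ x ∈ U, c / 2 * φ x ^ 3 + fderiv ℝ φ x (grad G φ x) = μ := by
    intro x hx
    have h := ricci_warped_snd hG hH hφ hpos hx hy a a'
    have htr : LinearMap.trace ℝ E (covGrad G φ x : E →L[ℝ] E) = c / 2 * φ x ^ 2 := by
      rw [hcov x hx]
      simp [hE]
      ring
    rw [hW x hx, hμ, htr, hE'] at h
    simp at h
    have h' : H y a a' * (c / 2 * φ x ^ 3 + fderiv ℝ φ x (grad G φ x) - μ) = 0 := by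
      linear_combination h
    linarith [(mul_eq_zero.1 h').resolve_left ha]
  have hc0 : c = 0 := hG.eq_zero_of_hess_eq hx hφ hpos hhess hconst
  refine ⟨riemann_eq_zero_of_ricci_eq_zero b ?_, fun u v => by simp [hhess x hx, hc0]⟩
  rw [hG.ricci_eq_half_scalar_smul b hx, hc x hx, hc0]
  simp

end LocalMetric

section Manifold

open LocalMetric Topology

variable {E : Type*} [NormedAddCommGroup E] [NormedSpace ℝ E]
  {H : Type*} [TopologicalSpace H] {I : ModelWithCorners ℝ E H}
  {M : Type*} [TopologicalSpace M] [ChartedSpace H M]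

theorem PseudoRiemannianMetric.contDiffOn_inChart [IsManifold I ∞ M]
    (g : PseudoRiemannianMetric I M) (x₀ : M) :
    ContDiffOn ℝ ∞ (g.val.inChart x₀) (extChartAt I x₀).target := by
  have : IsManifold I 1 M := IsManifold.of_le (n := ∞) (by simp)
  have h1 := ((trivializationAt (E →L[ℝ] E →L[ℝ] ℝ)
    (fun x : M => TangentSpace I x →L[ℝ] TangentSpace I x →L[ℝ] ℝ)
    x₀).contMDiffOn_section_baseSet_iff (IB := I) (n := ∞) (s := g.val)).1 g.contMDiff.contMDiffOn
  have hs : ∀ y ∈ (extChartAt I x₀).target, (extChartAt I x₀).symm y ∈ (chartAt H x₀).source :=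
    fun y hy => extChartAt_source I x₀ ▸ (extChartAt I x₀).map_target hy
  have h2 := h1.comp (contMDiffOn_extChartAt_symm x₀) (fun y hy => by simpa using hs y hy)
  refine (contMDiffOn_iff_contDiffOn.1 h2).congr fun y hy => ?_
  have hb : (extChartAt I x₀).symm y ∈ (trivializationAt E (TangentSpace I) x₀).baseSet := by
    simpa using hs y hy
  let D : E → E →L[ℝ] E := fun y' =>
    mfderivWithin 𝓘(ℝ, E) I (extChartAt I x₀).symm (range I) y'
  have hL : ((trivializationAt E (TangentSpace I) x₀).symmL ℝ ((extChartAt I x₀).symm y) :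
      E →L[ℝ] E) = D y :=
    (TangentBundle.symmL_trivializationAt (hs y hy)).trans
      (congrArg D ((extChartAt I x₀).right_inv hy))
  ext u v
  refine Eq.trans ?_ (inCoordinates_apply_eq₂ (E₃ := fun _ : M => ℝ) (F₃ := ℝ)
    hb hb (by simp)).symm
  have hu : (trivializationAt E (TangentSpace I) x₀).symm ((extChartAt I x₀).symm y) u = D y u :=
    (Bundle.Trivialization.symmL_apply (R := ℝ) _ hb _).symm.trans (DFunLike.congr_fun hL u)
  have hv : (trivializationAt E (TangentSpace I) x₀).symm ((extChartAt I x₀).symm y) v = D y v :=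
    (Bundle.Trivialization.symmL_apply (R := ℝ) _ hb _).symm.trans (DFunLike.congr_fun hL v)
  have ht : ∀ (x : M) (r : ℝ), (trivializationAt ℝ (fun _ : M => ℝ) x₀).linearMapAt ℝ x r = r := by
    intro x r
    simp
  rw [ht]
  exact (congrArg₂ (fun a b => g.val ((extChartAt I x₀).symm y) a b) hu hv).symm

theorem PseudoRiemannianMetric.isMetricOn_inChart [FiniteDimensional ℝ E] [I.Boundaryless]
    [IsManifold I ∞ M] (g : PseudoRiemannianMetric I M) (x₀ : M) :
    IsMetricOn (g.val.inChart x₀) (extChartAt I x₀).target where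
  isOpen := isOpen_extChartAt_target x₀
  contDiffOn := g.contDiffOn_inChart x₀
  symm y _ v w := g.symm _ _ _
  isInvertible y hy := by
    have : IsManifold I 1 M := IsManifold.of_le (n := ∞) (by simp)
    have hL := isInvertible_mfderivWithin_extChartAt_symm hy
    refine isInvertible_of_nondegenerate fun v hv => hL.injective ?_
    refine (g.nondegenerate _ _ fun w => ?_).trans (map_zero _).symm
    obtain ⟨w, rfl⟩ := hL.surjective w
    exact hv w

variable {E' : Type*} [NormedAddCommGroup E'] [NormedSpace ℝ E']
  {H' : Type*} [TopologicalSpace H'] {J : ModelWithCorners ℝ E' H'}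
  {F : Type*} [TopologicalSpace F] [ChartedSpace H' F]

theorem warpedProduct_inChart [IsManifold I 1 M] [IsManifold J 1 F] (g : BilinField I M)
    (f : M → ℝ) (h : BilinField J F) (x₀ : M) (y₀ : F) {z : E × E'}
    (hz : z ∈ (extChartAt (I.prod J) (x₀, y₀)).target) :
    (warpedProduct g f h).inChart (x₀, y₀) z =
      warped (g.inChart x₀) (f ∘ (extChartAt I x₀).symm) (h.inChart y₀) z := by
  have hz' : z.1 ∈ (extChartAt I x₀).target ∧ z.2 ∈ (extChartAt J y₀).target := by
    rw [extChartAt_prod] at hz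
    exact hz
  have hu : UniqueMDiffWithinAt 𝓘(ℝ, E × E') (range (I.prod J)) z :=
    (I.prod J).uniqueMDiffOn _ (extChartAt_target_subset_range _ hz)
  have hL := (mdifferentiableWithinAt_extChartAt_symm hz).hasMFDerivWithinAt
  have hL1 := (mdifferentiableWithinAt_extChartAt_symm hz'.1).hasMFDerivWithinAt
  have hL2 := (mdifferentiableWithinAt_extChartAt_symm hz'.2).hasMFDerivWithinAt
  have hfst : HasMFDerivAt 𝓘(ℝ, E × E') 𝓘(ℝ, E) Prod.fst z (ContinuousLinearMap.fst ℝ E E') :=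
    hasFDerivAt_fst.hasMFDerivAt
  have hsnd : HasMFDerivAt 𝓘(ℝ, E × E') 𝓘(ℝ, E') Prod.snd z (ContinuousLinearMap.snd ℝ E E') :=
    hasFDerivAt_snd.hasMFDerivAt
  have hr1 : range (I.prod J) ⊆ Prod.fst ⁻¹' range I := by
    rintro _ ⟨p, rfl⟩
    exact ⟨p.1, rfl⟩
  have hr2 : range (I.prod J) ⊆ Prod.snd ⁻¹' range J := by
    rintro _ ⟨p, rfl⟩
    exact ⟨p.2, rfl⟩
  have e1 := hu.eq
    ((mdifferentiableAt_fst (I := I) (I' := J)).hasMFDerivAt.comp_hasMFDerivWithinAt z hL)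
    (hL1.comp z hfst.hasMFDerivWithinAt hr1)
  have e2 := hu.eq
    ((mdifferentiableAt_snd (I := I) (I' := J)).hasMFDerivAt.comp_hasMFDerivWithinAt z hL)
    (hL2.comp z hsnd.hasMFDerivWithinAt hr2)
  refine ContinuousLinearMap.ext fun u => ContinuousLinearMap.ext fun v => ?_
  exact congrArg₂ (· + ·)
    (congrArg₂ (fun a b => g ((extChartAt I x₀).symm z.1) a b)
      (DFunLike.congr_fun e1 u) (DFunLike.congr_fun e1 v))
    (congrArg (f ((extChartAt I x₀).symm z.1) ^ 2 * ·)
      (congrArg₂ (fun a b => h ((extChartAt J y₀).symm z.2) a b)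
        (DFunLike.congr_fun e2 u) (DFunLike.congr_fun e2 v)))

end Manifold
end

noncomputable section

open LocalMetric Topology

theorem deriv_deriv_comp {E : Type*} [NormedAddCommGroup E] [NormedSpace ℝ E] {φ : E → ℝ}
    {c : ℝ → E} {t : ℝ} (hφ : ContDiffAt ℝ ∞ φ (c t)) (hc : ContDiffAt ℝ ∞ c t) :
    deriv (deriv (φ ∘ c)) t =
      fderiv ℝ (fderiv ℝ φ) (c t) (deriv c t) (deriv c t)
        + fderiv ℝ φ (c t) (deriv (deriv c) t) := by
  have hφ1 : ContDiffAt ℝ 1 φ (c t) := hφ.of_le (by simp)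
  have hc1 : ContDiffAt ℝ 1 c t := hc.of_le (by simp)
  have h1 : deriv (φ ∘ c) =ᶠ[𝓝 t] fun τ => fderiv ℝ φ (c τ) (deriv c τ) := by
    filter_upwards [hc1.eventually (by simp),
      hc1.continuousAt.eventually (hφ1.eventually (by simp))] with τ h2 h3
    exact ((h3.differentiableAt (by simp)).hasFDerivAt.comp_hasDerivAt τ
      (h2.differentiableAt (by simp)).hasDerivAt).deriv
  have h2 : HasFDerivAt (fderiv ℝ φ) (fderiv ℝ (fderiv ℝ φ) (c t)) (c t) :=
    ((hφ.fderiv_right (m := ∞) (by simp)).differentiableAt (by simp)).hasFDerivAt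
  have h3 : HasDerivAt c (deriv c t) t := (hc.differentiableAt (by simp)).hasDerivAt
  have h4 : HasDerivAt (deriv c) (deriv (deriv c) t) t :=
    (((hc.fderiv_right (m := ∞) (by simp)).clm_apply
      (contDiffAt_const (c := (1 : ℝ)))).differentiableAt (by simp)).hasDerivAt
  rw [h1.deriv_eq]
  exact ((h2.comp_hasDerivAt t h3).clm_apply h4).deriv

theorem exists_eq_mul_add_of_deriv_deriv_eq_zero {s : Set ℝ} (hs : IsOpen s) (hs' : s.OrdConnected)
    {F : ℝ → ℝ} (hF : ContDiffOn ℝ ∞ F s) (h : ∀ t ∈ s, deriv (deriv F) t = 0) :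
    ∃ a b : ℝ, ∀ t ∈ s, F t = a * t + b := by
  have hd : DifferentiableOn ℝ (deriv F) s :=
    (hF.deriv_of_isOpen (m := ∞) hs (by simp)).differentiableOn (by simp)
  obtain ⟨a, ha⟩ := hs.exists_is_const_of_deriv_eq_zero hs'.isPreconnected hd h
  have hF' : ∀ t ∈ s, HasDerivAt (fun τ => F τ - a * τ) 0 t := fun t ht => by
    have h1 := ((hF.contDiffAt (hs.mem_nhds ht)).differentiableAt (by simp)).hasDerivAt
    have h2 := h1.sub ((hasDerivAt_id t).const_mul a)
    rw [ha t ht, mul_one, sub_self] at h2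
    exact h2
  obtain ⟨b, hb⟩ := hs.exists_is_const_of_deriv_eq_zero hs'.isPreconnected
    (fun t ht => (hF' t ht).differentiableAt.differentiableWithinAt) (fun t ht => (hF' t ht).deriv)
  exact ⟨a, b, fun t ht => by linarith [hb t ht]⟩

section Manifold

variable {E : Type*} [NormedAddCommGroup E] [NormedSpace ℝ E]
  {H : Type*} [TopologicalSpace H] {I : ModelWithCorners ℝ E H}
  {M : Type*} [TopologicalSpace M] [ChartedSpace H M] [IsManifold I ∞ M]

theorem contDiffOn_comp_extChartAt_symm {f : M → ℝ} (hf : ContMDiff I 𝓘(ℝ, ℝ) ∞ f) (x₀ : M) :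
    ContDiffOn ℝ ∞ (f ∘ (extChartAt I x₀).symm) (extChartAt I x₀).target :=
  contMDiffOn_iff_contDiffOn.1 (hf.comp_contMDiffOn (contMDiffOn_extChartAt_symm x₀))

theorem isAffineFunction_of_hess_eq_zero [I.Boundaryless] {g : BilinField I M} {f : M → ℝ}
    (hf : ContMDiff I 𝓘(ℝ, ℝ) ∞ f)
    (h : ∀ x₀ : M, ∀ y ∈ (extChartAt I x₀).target, ∀ u v,
      hess (g.inChart x₀) (f ∘ (extChartAt I x₀).symm) y u v = 0) :
    IsAffineFunction g f := by
  intro γ s hs hs' ⟨hγ, hgeo⟩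
  have hF : ContDiffOn ℝ ∞ (f ∘ γ) s := contMDiffOn_iff_contDiffOn.1 (hf.comp_contMDiffOn hγ)
  refine exists_eq_mul_add_of_deriv_deriv_eq_zero hs hs' hF fun t ht => ?_
  set e := extChartAt I (γ t)
  have hγt : ContMDiffAt 𝓘(ℝ, ℝ) I ∞ γ t := hγ.contMDiffAt (hs.mem_nhds ht)
  have hc : ContDiffAt ℝ ∞ (fun τ => e (γ τ)) t :=
    contMDiffAt_iff_contDiffAt.1 (ContMDiffAt.comp t contMDiffAt_extChartAt hγt)
  have hmem : e (γ t) ∈ e.target := e.map_source (mem_extChartAt_source _)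
  have hφ : ContDiffAt ℝ ∞ (f ∘ e.symm) (e (γ t)) :=
    (contDiffOn_comp_extChartAt_symm hf (γ t)).contDiffAt
      ((isOpen_extChartAt_target (γ t)).mem_nhds hmem)
  have heq : f ∘ γ =ᶠ[𝓝 t] (f ∘ e.symm) ∘ fun τ => e (γ τ) := by
    filter_upwards [hγt.continuousAt.preimage_mem_nhds (extChartAt_source_mem_nhds (I := I) (γ t))]
      with τ hτ
    exact (congrArg f (e.left_inv hτ)).symm
  change deriv (deriv (f ∘ γ)) t = 0
  rw [heq.deriv.deriv_eq, deriv_deriv_comp hφ hc]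
  have h1 := h (γ t) _ hmem (deriv (fun τ => e (γ τ)) t) (deriv (fun τ => e (γ τ)) t)
  have h2 := congrArg (fderiv ℝ (f ∘ e.symm) (e (γ t)))
    (hgeo (γ t) t ht (mem_extChartAt_source _))
  rw [map_add, map_zero] at h2
  rw [hess] at h1
  linarith

end Manifold

end

theorem theorem2
    {B : Type*} [TopologicalSpace B] [ChartedSpace (EuclideanSpace ℝ (Fin 2)) B]
    [IsManifold (𝓡 2) ∞ B]
    {F : Type*} [TopologicalSpace F] [ChartedSpace (EuclideanSpace ℝ (Fin 2)) F]
    [IsManifold (𝓡 2) ∞ F] [Nonempty F]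
    (g : PseudoRiemannianMetric (𝓡 2) B) (h : PseudoRiemannianMetric (𝓡 2) F)
    (f : B → ℝ) (hf : ContMDiff (𝓡 2) 𝓘(ℝ, ℝ) ∞ f) (hf_pos : ∀ x, 0 < f x)
    (c : ℝ) (hc : IsScalarCurvature g.val (fun x => c * f x))
    (μ : ℝ) (hμ : μ ≠ 0) (hF : IsEinstein h.val μ)
    (hM : IsEinstein (warpedProduct g.val f h.val) 0) :
    IsFlat g.val ∧ IsAffineFunction g.val f := by
  have : IsManifold (𝓡 2) 1 B := IsManifold.of_le (n := ∞) (by simp)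
  have : IsManifold (𝓡 2) 1 F := IsManifold.of_le (n := ∞) (by simp)
  obtain ⟨y₀⟩ := ‹Nonempty F›
  have key : ∀ x₀ : B, ∀ x ∈ (extChartAt (𝓡 2) x₀).target,
      LocalMetric.riemann (g.val.inChart x₀) x = 0 ∧
        ∀ u v, LocalMetric.hess (g.val.inChart x₀) (f ∘ (extChartAt (𝓡 2) x₀).symm) x u v = 0 := by
    intro x₀ x hx
    have hy : extChartAt (𝓡 2) y₀ y₀ ∈ (extChartAt (𝓡 2) y₀).target := mem_extChartAt_target y₀
    refine LocalMetric.riemann_eq_zero_and_hess_eq_zero (PiLp.basisFun 2 ℝ (Fin 2))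
      (PiLp.basisFun 2 ℝ (Fin 2)) (g.isMetricOn_inChart x₀) (h.isMetricOn_inChart y₀)
      (contDiffOn_comp_extChartAt_symm hf x₀) (fun _ _ => hf_pos _) (hc x₀) hy (hF y₀ _ hy)
      (fun x hx => ?_) hx
    have hz : (x, extChartAt (𝓡 2) y₀ y₀) ∈
        (extChartAt ((𝓡 2).prod (𝓡 2)) (x₀, y₀)).target := by
      rw [extChartAt_prod]
      exact ⟨hx, hy⟩
    have hzn := (isOpen_extChartAt_target (I := (𝓡 2).prod (𝓡 2)) (x₀, y₀)).mem_nhds hz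
    rw [← LocalMetric.ricci_congr (Filter.eventuallyEq_of_mem hzn fun z hz =>
      warpedProduct_inChart g.val f h.val x₀ y₀ hz), hM (x₀, y₀) _ hz, zero_smul]
  exact ⟨fun x₀ x hx => (key x₀ x hx).1,
    isAffineFunction_of_hess_eq_zero hf fun x₀ x hx => (key x₀ x hx).2⟩
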